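/- Let $p$ be a prime number, let $R$ be a discrete valuation domain of characteristic $0$ with maximal ideal $pR$, let $G$ be a finite cyclic $p$-group, and let $M$ be an $R[G]$-lattice, i.e. a finitely generated left $R[G]$-module which is projective as an $R$-module. Then there exist finite $G$-sets $\Omega_0$ and $\Omega_1$ and a short exact sequence $$0\longrightarrow R[\Omega_1]\longrightarrow R[\Omega_0]\longrightarrow M\longrightarrow 0$$ of $R[G]$-lattices (the maps being $R[G]$-linear), where $R[\Omega]$ denotes the free $R$-module on $\Omega$ with the $R[G]$-module structure induced by the action of $G$ on $\Omega$. -/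

import Mathlib

/-- A (left) `R[G]`-module `M` is an `R[G]`-lattice if it is finitely generated over `R[G]` and
projective as an `R`-module. -/
structure IsGroupRingLattice (R G M : Type*) [CommRing R] [Group G] [AddCommGroup M]
    [Module R M] [Module (MonoidAlgebra R G) M] [IsScalarTower R (MonoidAlgebra R G) M] :
    Prop where
  finite : Module.Finite (MonoidAlgebra R G) M
  projective : Module.Projective R M

/-- The permutation module `R[Ω]` of a `G`-set `Ω`: the free `R`-module on `Ω`, regarded as an
`R[G]`-module through the linear extension of the action of `G` on `Ω`. -/
abbrev PermutationModule (R G Ω : Type*) [CommRing R] [Group G] [MulAction G Ω] :=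
  (Representation.ofMulAction R G Ω).asModule

/-! Let a generator of `G` act as `X`, and induct on the exponent `j` for which `X ^ p ^ j` acts
trivially. Write `D = X ^ p ^ j - 1`, `E = X ^ p ^ (j + 1) - 1` and `N = E / D`. If `E` kills `M`,
let `M'` be the submodule killed by `D`. Then `M / M'` is torsion-free over `R` and killed by `N`.

The arithmetic input is that `R[X] / N` is a principal ideal domain: `X - 1` is a uniformizer, since
`N` takes the value `p` at `1`. So `M / M'` is free over it. Lifting a basis to `M` gives a map
`(R[X]/E)^k → M`, which together with a resolution `Q₁ → Q₀ → M'` yields a surjection `Q₀ ×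
(R[X]/E)^k → M`. Its kernel is an extension of `N (R[X]/E)^k ≅ (R[X]/D)^k` by `Q₁`. The extension
splits because `D` kills `Q₀`, so the kernel is again a permutation module. This is
`HasPermutationResolution.succ`. -/

open Polynomial

/-! ### A criterion for discrete valuation rings -/

/-- A noetherian ring in which every non-unit is divisible by a fixed non-nilpotent non-unit is a
principal ideal domain. -/
theorem isDomain_and_isPrincipalIdealRing_of_dvd {S : Type*} [CommRing S] [IsNoetherianRing S]
    {π : S} (hπ : ¬ IsUnit π) (hnil : ¬ IsNilpotent π) (hdvd : ∀ a : S, ¬ IsUnit a → π ∣ a) :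
    IsDomain S ∧ IsPrincipalIdealRing S := by
  have : Nontrivial S := by
    by_contra h
    rw [not_nontrivial_iff_subsingleton] at h
    exact hnil ⟨0, Subsingleton.elim _ _⟩
  have hmul : ∀ a : S, π ∣ a → ¬ IsUnit a := fun a h ha => hπ (isUnit_of_dvd_unit h ha)
  have : IsLocalRing S := IsLocalRing.of_nonunits_add fun a b ha hb =>
    hmul _ (dvd_add (hdvd a ha) (hdvd b hb))
  have hfac : ∀ a : S, a ≠ 0 → ∃ (n : ℕ) (u : Sˣ), a = π ^ n * u := by
    intro a ha
    have hex : ∃ n, ¬ π ^ n ∣ a := by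
      by_contra! h
      -- Krull's intersection theorem excludes a nonzero `a` divisible by every power of `π`.
      have hmem : a ∈ (⨅ n : ℕ, Ideal.span {π} ^ n : Ideal S) := by
        rw [Submodule.mem_iInf]
        intro n
        rw [Ideal.span_singleton_pow, Ideal.mem_span_singleton]
        exact h n
      rw [Ideal.iInf_pow_eq_bot_of_isLocalRing _
        (by rwa [Ne, Ideal.span_singleton_eq_top])] at hmem
      exact ha (by simpa using hmem)
    classical
    obtain ⟨n, hn⟩ : ∃ n, Nat.find hex = n + 1 := by
      refine Nat.exists_eq_succ_of_ne_zero fun h => ?_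
      exact Nat.find_spec hex (by rw [h]; simp)
    obtain ⟨b, rfl⟩ := not_not.mp (Nat.find_min hex (m := n) (by omega))
    have hb : IsUnit b := by
      by_contra hb
      refine Nat.find_spec hex ?_
      rw [hn, pow_succ]
      exact mul_dvd_mul_left _ (hdvd b hb)
    exact ⟨n, hb.unit, rfl⟩
  have hdom : IsDomain S := by
    have : NoZeroDivisors S := by
      refine ⟨fun {a b} hab => ?_⟩
      by_contra! h
      obtain ⟨m, u, rfl⟩ := hfac a h.1
      obtain ⟨n, v, rfl⟩ := hfac b h.2
      refine hnil ⟨m + n, ?_⟩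
      have : π ^ (m + n) * ((u * v : Sˣ) : S) = 0 := by
        rw [← hab, pow_add]; push_cast; ring
      rwa [Units.mul_left_eq_zero] at this
    exact NoZeroDivisors.to_isDomain S
  refine ⟨hdom, ?_⟩
  have hprime : Irreducible π := by
    refine ⟨hπ, fun a b hab => ?_⟩
    by_contra! h
    obtain ⟨a', rfl⟩ := hdvd a h.1
    obtain ⟨b', rfl⟩ := hdvd b h.2
    have h0 : π ≠ 0 := fun h => hnil (h ▸ IsNilpotent.zero)
    refine hπ (IsUnit.of_mul_eq_one (a' * b') ?_)
    refine mul_left_cancel₀ h0 ?_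
    linear_combination -hab
  have := IsDiscreteValuationRing.ofHasUnitMulPowIrreducibleFactorization (R := S)
    ⟨π, hprime, fun {a} ha => by
      obtain ⟨n, u, rfl⟩ := hfac a ha
      exact ⟨n, u, rfl⟩⟩
  infer_instance

/-! ### The cyclotomic quotients of `R[X]` -/

section cyclotomic

variable {R : Type*} [CommRing R]

/-- The polynomial `1 + X ^ q + ⋯ + X ^ (q * (p - 1))`. -/
noncomputable def normPoly (R : Type*) [CommRing R] (p q : ℕ) : R[X] :=
  ∑ i ∈ Finset.range p, (X ^ q) ^ i

theorem normPoly_mul (p q : ℕ) : normPoly R p q * (X ^ q - 1) = X ^ (q * p) - 1 := by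
  rw [normPoly, geom_sum_mul, pow_mul]

theorem eval_one_normPoly (p q : ℕ) : (normPoly R p q).eval 1 = p := by
  simp [normPoly, eval_finsetSum]

theorem monic_normPoly [Nontrivial R] {p q : ℕ} (hp : p ≠ 0) (hq : q ≠ 0) :
    (normPoly R p q).Monic := by
  have h := normPoly_mul (R := R) p q
  have h1 : (X ^ q - 1 : R[X]).Monic := monic_X_pow_sub_C 1 hq
  have h2 : (X ^ (q * p) - 1 : R[X]).Monic := monic_X_pow_sub_C 1 (mul_ne_zero hq hp)
  rw [← h] at h2
  exact h1.of_mul_monic_right h2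

theorem X_sub_one_dvd_sub_C_eval (a : R[X]) : (X - 1 : R[X]) ∣ a - C (a.eval 1) := by
  have := X_sub_C_dvd_sub_C_eval (a := (1 : R)) (p := a)
  simpa using this

theorem X_sub_one_dvd_natCast_sub_normPoly (p q : ℕ) :
    (X - 1 : R[X]) ∣ (p : R[X]) - normPoly R p q := by
  have := X_sub_one_dvd_sub_C_eval (normPoly R p q)
  rw [eval_one_normPoly] at this
  rw [dvd_sub_comm]
  simpa using this

/-- If `R` is a local ring with maximal ideal `pR` and characteristic zero, then
`R[X] / (1 + X ^ q + ⋯ + X ^ (q * (p - 1)))` is a principal ideal domain for `q` a power of `p`. -/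
theorem isDomain_and_isPrincipalIdealRing_quotient_normPoly [IsDomain R] [IsNoetherianRing R]
    [IsLocalRing R] [CharZero R] {p : ℕ} (hp : p.Prime)
    (hR : IsLocalRing.maximalIdeal R = Ideal.span {(p : R)}) (j : ℕ) :
    IsDomain (R[X] ⧸ Ideal.span {normPoly R p (p ^ j)}) ∧
      IsPrincipalIdealRing (R[X] ⧸ Ideal.span {normPoly R p (p ^ j)}) := by
  set N := normPoly R p (p ^ j) with hN
  have hmonic : N.Monic := monic_normPoly hp.ne_zero (pow_ne_zero _ hp.ne_zero)
  have : Module.Finite R (R[X] ⧸ Ideal.span {N}) := hmonic.finite_quotient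
  let mk := Ideal.Quotient.mk (Ideal.span {N})
  have hmkN : mk N = 0 := Ideal.Quotient.eq_zero_iff_mem.mpr (Ideal.mem_span_singleton_self N)
  have hpdvd : mk (X - 1) ∣ (p : R[X] ⧸ Ideal.span {N}) := by
    have := map_dvd mk (X_sub_one_dvd_natCast_sub_normPoly (R := R) p (p ^ j))
    rwa [map_sub mk (p : R[X]), ← hN, hmkN, sub_zero, map_natCast] at this
  have hmax : ∀ J : Ideal (R[X] ⧸ Ideal.span {N}), J.IsMaximal →
      mk (X - 1) ∈ J ∧ ∀ r : R, mk (C r) ∈ J → r ∈ IsLocalRing.maximalIdeal R := by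
    intro J hJ
    have hcomap := Ideal.isMaximal_comap_of_isIntegral_of_isMaximal (R := R) J
    have hJR := IsLocalRing.eq_maximalIdeal hcomap
    have hmem : ∀ r : R, mk (C r) ∈ J ↔ r ∈ IsLocalRing.maximalIdeal R := by
      intro r
      rw [← hJR, Ideal.mem_comap]
      rfl
    refine ⟨?_, fun r hr => (hmem r).mp hr⟩
    have hpJ : (p : R[X] ⧸ Ideal.span {N}) ∈ J := by
      have := (hmem (p : R)).mpr (by rw [hR]; exact Ideal.mem_span_singleton_self _)
      simpa using this
    -- Modulo `p`, `(X - 1) ^ p ^ (j + 1)` is `X ^ p ^ (j + 1) - 1`, a multiple of `N`; as `p` lies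
    -- in `J`, so does `X - 1`.
    obtain ⟨r, hr⟩ := exists_add_pow_prime_pow_eq hp (X - 1 : R[X]) 1 (j + 1)
    have hpow : (X - 1 : R[X]) ^ p ^ (j + 1) = N * (X ^ p ^ j - 1) - (p : R[X]) * ((X - 1) * r) := by
      rw [hN, normPoly_mul, ← pow_succ]
      rw [sub_add_cancel, one_pow] at hr
      linear_combination -hr
    refine hJ.isPrime.mem_of_pow_mem (p ^ (j + 1)) ?_
    rw [← map_pow, hpow, map_sub, map_mul, map_mul, hmkN, zero_mul, zero_sub, map_natCast]
    exact J.neg_mem (J.mul_mem_right _ hpJ)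
  have hnontriv : Nontrivial (R[X] ⧸ Ideal.span {N}) := by
    refine Ideal.Quotient.nontrivial_iff.mpr fun h => ?_
    rw [Ideal.span_singleton_eq_top] at h
    have := h.map (evalRingHom (1 : R))
    rw [coe_evalRingHom, eval_one_normPoly] at this
    have hm : (p : R) ∈ IsLocalRing.maximalIdeal R := by
      rw [hR]; exact Ideal.mem_span_singleton_self _
    exact (IsLocalRing.mem_maximalIdeal _).mp hm this
  refine isDomain_and_isPrincipalIdealRing_of_dvd (π := mk (X - 1)) ?_ ?_ ?_
  · obtain ⟨J, hJ⟩ := Ideal.exists_maximal (R[X] ⧸ Ideal.span {N})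
    exact fun hu => hJ.ne_top (J.eq_top_of_isUnit_mem (hmax J hJ).1 hu)
  -- Nilpotency of `X - 1` would make the monic `N` divide the nonzero constant `p ^ k`, so `N = 1`;
  -- evaluating at `1` gives `p = 1`.
  · rintro ⟨k, hk⟩
    have hpk : mk (C ((p : R) ^ k)) = 0 := by
      obtain ⟨c, hc⟩ := hpdvd
      rw [C_pow, map_pow, map_natCast, map_natCast, hc, mul_pow, hk, zero_mul]
    have hdvd : N ∣ C ((p : R) ^ k) :=
      Ideal.mem_span_singleton.mp (Ideal.Quotient.eq_zero_iff_mem.mp hpk)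
    have hne : (p : R) ^ k ≠ 0 := pow_ne_zero _ (Nat.cast_ne_zero.mpr hp.ne_zero)
    have hdeg : N.natDegree = 0 := by
      have := natDegree_le_of_dvd hdvd (C_ne_zero.mpr hne)
      simpa using this
    have hone : N = 1 := hmonic.natDegree_eq_zero.mp hdeg
    have : (p : R) = 1 := by rw [← eval_one_normPoly (R := R) p (p ^ j), ← hN, hone, eval_one]
    exact hp.one_lt.ne' (by exact_mod_cast this)
  · intro a ha
    obtain ⟨J, hJ, haJ⟩ := exists_max_ideal_of_mem_nonunits ha
    obtain ⟨a, rfl⟩ := Ideal.Quotient.mk_surjective a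
    have hda : mk (X - 1) ∣ mk a - mk (C (a.eval 1)) := by
      rw [← map_sub]
      exact map_dvd mk (X_sub_one_dvd_sub_C_eval a)
    have hCJ : mk (C (a.eval 1)) ∈ J := by
      have := J.sub_mem haJ (J.mem_of_dvd hda (hmax J hJ).1)
      rwa [sub_sub_cancel] at this
    have hr := (hmax J hJ).2 _ hCJ
    rw [hR, Ideal.mem_span_singleton] at hr
    have hdC : mk (X - 1) ∣ mk (C (a.eval 1)) := by
      refine hpdvd.trans ?_
      have := map_dvd (mk.comp C) hr
      simpa using this
    exact (dvd_sub_left hdC).mp hda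

end cyclotomic

/-! ### Freeness over the cyclotomic quotient -/

section freeness

variable {R : Type*} [CommRing R] [IsDomain R] [IsNoetherianRing R] [IsLocalRing R] [CharZero R]
  {W : Type*} [AddCommGroup W] [Module R W] [Module R[X] W] [IsScalarTower R R[X] W]
  [Module.Finite R[X] W] [Module.IsTorsionFree R W]

/-- A finitely generated `R`-torsion-free `R[X]`-module annihilated by `normPoly R p (p ^ j)` is
free over the quotient of `R[X]` by that polynomial. -/
theorem exists_generators_of_normPoly_smul {p : ℕ} (hp : p.Prime)
    (hR : IsLocalRing.maximalIdeal R = Ideal.span {(p : R)}) (j : ℕ)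
    (hW : ∀ w : W, normPoly R p (p ^ j) • w = 0) :
    ∃ (k : ℕ) (w : Fin k → W), (∀ x, ∃ a : Fin k → R[X], ∑ i, a i • w i = x) ∧
      ∀ a : Fin k → R[X], ∑ i, a i • w i = 0 → ∀ i, normPoly R p (p ^ j) ∣ a i := by
  obtain ⟨hdom, hpid⟩ := isDomain_and_isPrincipalIdealRing_quotient_normPoly hp hR j
  have hmonic : (normPoly R p (p ^ j)).Monic :=
    monic_normPoly hp.ne_zero (pow_ne_zero _ hp.ne_zero)
  set N := normPoly R p (p ^ j) with hN
  have : Module.Finite R (R[X] ⧸ Ideal.span {N}) := hmonic.finite_quotient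
  have htors : Module.IsTorsionBySet R[X] W (Ideal.span {N}) :=
    (Module.isTorsionBySet_span_singleton_iff N).mpr fun {w} => hW w
  let _ : Module (R[X] ⧸ Ideal.span {N}) W := htors.module
  have hsmul : ∀ (a : R[X]) (x : W), Ideal.Quotient.mk (Ideal.span {N}) a • x = a • x :=
    fun _ _ => rfl
  have : IsScalarTower R[X] (R[X] ⧸ Ideal.span {N}) W := htors.isScalarTower
  have : IsScalarTower R (R[X] ⧸ Ideal.span {N}) W := htors.isScalarTower
  have : Module.Finite (R[X] ⧸ Ideal.span {N}) W :=
    Module.Finite.of_restrictScalars_finite R[X] _ _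
  have : Module.IsTorsionFree (R[X] ⧸ Ideal.span {N}) W := by
    refine Module.IsTorsionFree.of_smul_eq_zero fun s x hsx => ?_
    by_contra! h
    -- An integral nonzero `s` divides a nonzero element of `R`, which reduces to torsion over `R`.
    obtain ⟨r, hr, t, ht⟩ := ((Algebra.IsIntegral.isIntegral (R := R) s).isAlgebraic
      ).exists_nonzero_dvd (mem_nonZeroDivisors_of_ne_zero h.1)
    have : r • x = 0 := by
      rw [← algebraMap_smul (R[X] ⧸ Ideal.span {N}), ht, mul_comm, mul_smul, hsx, smul_zero]
    exact (smul_ne_zero hr h.2) this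
  let b := Module.finBasis (R[X] ⧸ Ideal.span {N}) W
  refine ⟨_, b, fun x => ?_, fun a ha i => ?_⟩
  · choose a ha using fun i => Ideal.Quotient.mk_surjective (b.repr x i)
    refine ⟨a, ?_⟩
    conv_rhs => rw [← b.sum_repr x]
    exact Finset.sum_congr rfl fun i _ => by rw [← ha i, hsmul]
  · have := Fintype.linearIndependent_iff.mp b.linearIndependent
      (fun i => Ideal.Quotient.mk _ (a i)) ha i
    exact Ideal.mem_span_singleton.mp (Ideal.Quotient.eq_zero_iff_mem.mp this)

end freeness

/-! ### Permutation modules over `R[X]` -/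

section permutation

variable (R : Type*) [CommRing R]

/-- An `R[X]`-module on which `X ^ q` acts trivially and which has a finite `R`-basis permuted
by `X`. -/
def IsPermutationOfPeriod (q : ℕ) (Q : Type*) [AddCommGroup Q] [Module R Q] [Module R[X] Q] :
    Prop :=
  (∀ x : Q, (X ^ q : R[X]) • x = x) ∧ ∃ (Ω : Type) (_ : Finite Ω) (σ : Equiv.Perm Ω)
    (b : Module.Basis Ω R Q), ∀ i, (X : R[X]) • b i = b (σ i)

namespace IsPermutationOfPeriod

variable {R} {q : ℕ} {P Q : Type*} [AddCommGroup P] [Module R P] [Module R[X] P]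
  [AddCommGroup Q] [Module R Q] [Module R[X] Q]

theorem mono {q' : ℕ} (h : IsPermutationOfPeriod R q Q) (hq : q ∣ q') :
    IsPermutationOfPeriod R q' Q := by
  obtain ⟨c, rfl⟩ := hq
  refine ⟨fun x => ?_, h.2⟩
  rw [pow_mul]
  induction c with
  | zero => simp
  | succ c ih => rw [pow_succ, mul_smul, h.1, ih]

theorem prod (hP : IsPermutationOfPeriod R q P) (hQ : IsPermutationOfPeriod R q Q) :
    IsPermutationOfPeriod R q (P × Q) := by
  obtain ⟨hP, Ω, _, σ, b, hb⟩ := hP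
  obtain ⟨hQ, Ω', _, σ', b', hb'⟩ := hQ
  refine ⟨fun x => Prod.ext (hP _) (hQ _), Ω ⊕ Ω', inferInstance, σ.sumCongr σ', b.prod b', ?_⟩
  rintro (i | i) <;> ext <;> simp [hb, hb']

theorem pi (hQ : IsPermutationOfPeriod R q Q) (k : ℕ) :
    IsPermutationOfPeriod R q (Fin k → Q) := by
  obtain ⟨hQ, Ω, _, σ, b, hb⟩ := hQ
  refine ⟨fun x => funext fun i => hQ _, Σ _ : Fin k, Ω, inferInstance,
    Equiv.sigmaCongrRight fun _ => σ, Pi.basis fun _ => b, ?_⟩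
  rintro ⟨j, i⟩
  rw [Equiv.sigmaCongrRight_apply, Pi.basis_apply, Pi.basis_apply, ← Pi.single_smul, hb]

theorem quotient [Nontrivial R] {q : ℕ} (hq : q ≠ 0) :
    IsPermutationOfPeriod R q (R[X] ⧸ Ideal.span {(X ^ q - 1 : R[X])}) := by
  have : NeZero q := ⟨hq⟩
  have hX : ∀ x : R[X] ⧸ Ideal.span {(X ^ q - 1 : R[X])}, (X ^ q : R[X]) • x = x := by
    intro x
    obtain ⟨a, rfl⟩ := Ideal.Quotient.mk_surjective x
    rw [← sub_eq_zero]
    refine Ideal.Quotient.eq_zero_iff_mem.mpr (Ideal.mem_span_singleton.mpr ⟨a, ?_⟩)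
    change X ^ q * a - a = _
    ring
  have hmonic : (X ^ q - 1 : R[X]).Monic := monic_X_pow_sub_C 1 hq
  have hdeg : (X ^ q - 1 : R[X]).natDegree = q := natDegree_X_pow_sub_C (r := 1)
  let b : Module.Basis (Fin q) R (R[X] ⧸ Ideal.span {(X ^ q - 1 : R[X])}) :=
    (AdjoinRoot.powerBasis' hmonic).basis.reindex (finCongr hdeg)
  have hb : ∀ i, b i = Ideal.Quotient.mk _ (X ^ (i : ℕ)) := by
    intro i
    change (AdjoinRoot.powerBasis' hmonic).basis.reindex (finCongr hdeg) i = _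
    rw [Module.Basis.reindex_apply, PowerBasis.coe_basis, map_pow]
    rfl
  refine ⟨hX, Fin q, inferInstance, Equiv.addRight 1, b, fun i => ?_⟩
  rw [hb, hb, Equiv.coe_addRight, Fin.val_add, Fin.val_one', Nat.add_mod_mod, map_pow, map_pow]
  have h1 : (Ideal.Quotient.mk (Ideal.span {(X ^ q - 1 : R[X])}) X) ^ q = 1 := by
    rw [← map_pow, ← sub_eq_zero, ← map_one (Ideal.Quotient.mk _), ← map_sub]
    exact Ideal.Quotient.eq_zero_iff_mem.mpr (Ideal.mem_span_singleton_self _)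
  rw [← pow_eq_pow_mod _ h1, pow_succ', ← map_pow, ← map_mul]
  rfl

end IsPermutationOfPeriod

end permutation

universe u v

/-! ### Maps between powers of cyclic `R[X]`-modules -/

section quotient

variable {R : Type u} [CommRing R] {T : Type v} [AddCommGroup T] [Module R[X] T]

theorem exists_lift_pi_quotient {D : R[X]} {k : ℕ} (t : Fin k → T) (ht : ∀ i, D • t i = 0) :
    ∃ h : (Fin k → R[X] ⧸ Ideal.span {D}) →ₗ[R[X]] T,
      ∀ a : Fin k → R[X], h (fun i => (Ideal.span {D}).mkQ (a i)) = ∑ i, a i • t i := by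
  have hle : ∀ i, Ideal.span {D} ≤ LinearMap.ker (LinearMap.toSpanSingleton R[X] T (t i)) := by
    intro i a ha
    obtain ⟨c, rfl⟩ := Ideal.mem_span_singleton'.mp ha
    rw [LinearMap.mem_ker, LinearMap.toSpanSingleton_apply, mul_smul, ht, smul_zero]
  refine ⟨∑ i, (Submodule.liftQ _ _ (hle i)) ∘ₗ LinearMap.proj i, fun a => ?_⟩
  rw [LinearMap.sum_apply]
  refine Finset.sum_congr rfl fun i _ => ?_
  rw [LinearMap.comp_apply, LinearMap.proj_apply, Submodule.mkQ_apply, Submodule.liftQ_apply,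
    LinearMap.toSpanSingleton_apply]

theorem exists_mul_pi_quotient [IsDomain R] {N D E : R[X]} (h : N * D = E) (hN : N ≠ 0) (k : ℕ) :
    ∃ ν : (Fin k → R[X] ⧸ Ideal.span {D}) →ₗ[R[X]] (Fin k → R[X] ⧸ Ideal.span {E}),
      Function.Injective ν ∧ ∀ a : Fin k → R[X], ν (fun i => (Ideal.span {D}).mkQ (a i)) =
        fun i => (Ideal.span {E}).mkQ (N * a i) := by
  have hmem : ∀ a : R[X], N * a ∈ Ideal.span {E} ↔ a ∈ Ideal.span {D} := by
    intro a
    rw [Ideal.mem_span_singleton, Ideal.mem_span_singleton, ← h, mul_dvd_mul_iff_left hN]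
  let μ : (R[X] ⧸ Ideal.span {D}) →ₗ[R[X]] (R[X] ⧸ Ideal.span {E}) :=
    Submodule.mapQ _ _ (LinearMap.lsmul R[X] R[X] N) fun a ha => (hmem a).mpr ha
  have hμ : Function.Injective μ := by
    rw [injective_iff_map_eq_zero]
    intro x hx
    obtain ⟨a, rfl⟩ := Submodule.mkQ_surjective _ x
    exact (Submodule.Quotient.mk_eq_zero _).mpr
      ((hmem a).mp ((Submodule.Quotient.mk_eq_zero _).mp hx))
  exact ⟨μ.compLeft (Fin k), hμ.comp_left, fun a => rfl⟩

end quotient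

/-! ### Permutation resolutions by induction -/

/-- An `R[X]`-module has a two-term resolution by modules with an `R`-basis permuted by `X`, the
permutations being of order dividing `q`. -/
def HasPermutationResolution (R : Type u) [CommRing R] (q : ℕ) (M : Type v) [AddCommGroup M]
    [Module R[X] M] : Prop :=
  ∃ (Q₁ Q₀ : Type u) (_ : AddCommGroup Q₁) (_ : Module R Q₁) (_ : Module R[X] Q₁)
    (_ : IsScalarTower R R[X] Q₁) (_ : AddCommGroup Q₀) (_ : Module R Q₀) (_ : Module R[X] Q₀)
    (_ : IsScalarTower R R[X] Q₀) (f : Q₁ →ₗ[R[X]] Q₀) (g : Q₀ →ₗ[R[X]] M),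
    IsPermutationOfPeriod R q Q₁ ∧ IsPermutationOfPeriod R q Q₀ ∧
      Function.Injective f ∧ Function.Exact f g ∧ Function.Surjective g

section induction

variable {R : Type u} [CommRing R] [IsDomain R]
  {M : Type v} [AddCommGroup M] [Module R M] [Module R[X] M] [IsScalarTower R R[X] M]

theorem hasPermutationResolution_one [IsPrincipalIdealRing R] [Module.Finite R M]
    [Module.IsTorsionFree R M] (hM : ∀ x : M, (X : R[X]) • x = x) :
    HasPermutationResolution R 1 M := by
  let b := Module.finBasis R M
  -- `AEval` at `1` is a copy of `M` in the universe of `R`, with `X` acting trivially.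
  let g : Module.AEval R (Fin (Module.finrank R M) → R) (1 : R) →ₗ[R[X]] M :=
    LinearMap.ofAEval (1 : R) (b.equivFun.symm : (Fin (Module.finrank R M) → R) →ₗ[R] M)
      fun x => by rw [one_smul, hM]
  have hg : Function.Bijective g := b.equivFun.symm.bijective
  have hX : ∀ x : Module.AEval R (Fin (Module.finrank R M) → R) (1 : R), (X : R[X]) • x = x := by
    intro x
    refine hg.1 ?_
    rw [map_smul, hM]
  refine ⟨PUnit, Module.AEval R (Fin (Module.finrank R M) → R) (1 : R), inferInstance,
    inferInstance, inferInstance, inferInstance, inferInstance, inferInstance, inferInstance,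
    inferInstance, 0, g, ⟨fun x => rfl, Empty, inferInstance, 1, Module.Basis.empty _, ?_⟩,
    ⟨?_, _, inferInstance, 1, (Pi.basisFun R (Fin (Module.finrank R M))).map (Module.AEval.of R _ 1),
    fun i => hX _⟩, ?_, ?_, hg.2⟩
  · exact fun i => i.elim
  · intro x
    rw [pow_one, hX]
  · exact fun _ _ _ => rfl
  · intro x
    constructor
    · intro hx
      exact ⟨0, (hg.1 (by rw [hx, map_zero, map_zero])).symm⟩
    · rintro ⟨y, rfl⟩
      rw [LinearMap.zero_apply, map_zero]

/-- The kernel of the enlarged surjection consists of the pairs `(f x + s c, N c)`, where `s` is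
chosen so that `g (s c)` cancels the image of `N c` in `M`. -/
theorem HasPermutationResolution.succ [IsNoetherianRing R] [IsLocalRing R] [CharZero R]
    [Module.Finite R[X] M] [Module.IsTorsionFree R M] {p : ℕ} (hp : p.Prime)
    (hR : IsLocalRing.maximalIdeal R = Ideal.span {(p : R)}) {j : ℕ}
    (hM : ∀ x : M, (X ^ p ^ (j + 1) : R[X]) • x = x)
    (h : HasPermutationResolution R (p ^ j) (Submodule.torsionBy R[X] M (X ^ p ^ j - 1))) :
    HasPermutationResolution R (p ^ (j + 1)) M := by
  have hq : p ^ j ≠ 0 := pow_ne_zero _ hp.ne_zero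
  have hq' : p ^ (j + 1) ≠ 0 := pow_ne_zero _ hp.ne_zero
  set N := normPoly R p (p ^ j) with hN
  have hN0 : N ≠ 0 := (monic_normPoly hp.ne_zero hq).ne_zero
  set D : R[X] := X ^ p ^ j - 1 with hD
  set E : R[X] := X ^ p ^ (j + 1) - 1 with hE
  have hND : N * D = E := by rw [hN, hD, normPoly_mul, ← pow_succ]
  have hEM : ∀ x : M, E • x = 0 := fun x => by rw [hE, sub_smul, hM, one_smul, sub_self]
  set M' := Submodule.torsionBy R[X] M D with hM'
  have hNM : ∀ x : M, N • x ∈ M' := fun x => by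
    rw [Submodule.mem_torsionBy_iff, ← mul_smul, mul_comm, hND, hEM]
  have : Module.IsTorsionFree R (M ⧸ M') := by
    refine Module.IsTorsionFree.of_smul_eq_zero fun r x hx => ?_
    by_contra! hne
    obtain ⟨y, rfl⟩ := Submodule.mkQ_surjective _ x
    rw [Submodule.mkQ_apply, ← Submodule.Quotient.mk_smul, Submodule.Quotient.mk_eq_zero,
      Submodule.mem_torsionBy_iff, smul_comm] at hx
    refine hne.2 ((Submodule.Quotient.mk_eq_zero _).mpr ?_)
    rw [Submodule.mem_torsionBy_iff]
    exact (smul_eq_zero_iff_right hne.1).mp hx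
  have hNW : ∀ w : M ⧸ M', N • w = 0 := by
    intro w
    obtain ⟨y, rfl⟩ := Submodule.mkQ_surjective _ w
    rw [← map_smul]
    exact (Submodule.Quotient.mk_eq_zero _).mpr (hNM y)
  obtain ⟨k, w, hspan, hind⟩ := exists_generators_of_normPoly_smul hp hR j hNW
  choose m hm using fun i => Submodule.mkQ_surjective _ (w i)
  obtain ⟨Q₁, Q₀, _, _, _, _, _, _, _, _, f, g, hQ₁, hQ₀, hf, hfg, hg⟩ := h
  -- `N • m i` lies in `M'`, so its negative lifts to `Q₀`. As `D` kills `Q₀`, the lifts define `s`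
  -- on `(R[X]/D)^k`, which splits the kernel.
  choose t ht using fun i => hg ⟨-(N • m i), M'.neg_mem (hNM (m i))⟩
  obtain ⟨h, hh⟩ := exists_lift_pi_quotient (D := E) m fun i => hEM _
  obtain ⟨s, hs⟩ := exists_lift_pi_quotient (D := D) t fun i => by
    rw [hD, sub_smul, hQ₀.1, one_smul, sub_self]
  obtain ⟨ν, hνinj, hν⟩ := exists_mul_pi_quotient hND hN0 k
  have hsurj : ∀ (F : R[X]) (c : Fin k → R[X] ⧸ Ideal.span {F}),
      ∃ a : Fin k → R[X], c = fun i => (Ideal.span {F}).mkQ (a i) := by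
    intro F c
    choose a ha using fun i => Submodule.mkQ_surjective _ (c i)
    exact ⟨a, funext fun i => (ha i).symm⟩
  have hgs : ∀ c, (g (s c) : M) + h (ν c) = 0 := by
    intro c
    obtain ⟨a, rfl⟩ := hsurj D c
    rw [hs, hν, hh, map_sum, Submodule.coe_sum, ← Finset.sum_add_distrib]
    refine Finset.sum_eq_zero fun i _ => ?_
    rw [map_smul, ht, Submodule.coe_smul, smul_neg, mul_comm, mul_smul, neg_add_cancel]
  have hmod : ∀ a : Fin k → R[X], M'.mkQ (∑ i, a i • m i) = ∑ i, a i • w i := by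
    intro a
    rw [map_sum]
    exact Finset.sum_congr rfl fun i _ => by rw [map_smul, hm]
  let f' : Q₁ × (Fin k → R[X] ⧸ Ideal.span {D}) →ₗ[R[X]] Q₀ × (Fin k → R[X] ⧸ Ideal.span {E}) :=
    (f.coprod s).prod (ν ∘ₗ LinearMap.snd R[X] _ _)
  let g' : Q₀ × (Fin k → R[X] ⧸ Ideal.span {E}) →ₗ[R[X]] M := (M'.subtype ∘ₗ g).coprod h
  have hf' : ∀ x c, f' (x, c) = (f x + s c, ν c) := fun _ _ => rfl
  have hg' : ∀ y b, g' (y, b) = g y + h b := fun _ _ => rfl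
  refine ⟨Q₁ × (Fin k → R[X] ⧸ Ideal.span {D}), Q₀ × (Fin k → R[X] ⧸ Ideal.span {E}),
    inferInstance, inferInstance, inferInstance, inferInstance, inferInstance, inferInstance,
    inferInstance, inferInstance, f', g', ?_, ?_, ?_, ?_, ?_⟩
  · exact (hQ₁.prod ((IsPermutationOfPeriod.quotient hq).pi k)).mono (pow_dvd_pow p j.le_succ)
  · exact (hQ₀.mono (pow_dvd_pow p j.le_succ)).prod ((IsPermutationOfPeriod.quotient hq').pi k)
  · rw [injective_iff_map_eq_zero]
    rintro ⟨x, c⟩ hx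
    rw [hf', Prod.mk_eq_zero] at hx
    obtain rfl : c = 0 := hνinj (by rw [hx.2, map_zero])
    obtain rfl : x = 0 := hf (by rw [map_zero, ← hx.1, map_zero, add_zero])
    rfl
  · rintro ⟨y, b⟩
    constructor
    · intro hyb
      obtain ⟨a, rfl⟩ := hsurj E b
      rw [hg', hh] at hyb
      have hzero : ∑ i, a i • w i = 0 := by
        rw [← hmod, eq_neg_of_add_eq_zero_right hyb]
        exact (Submodule.Quotient.mk_eq_zero _).mpr (M'.neg_mem (g y).2)
      -- Relations among the `w i` have coefficients divisible by `N`, so the second component comes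
      -- from `ν`.
      choose c hc using hind a hzero
      have hb : (fun i => (Ideal.span {E}).mkQ (a i)) =
          ν (fun i => (Ideal.span {D}).mkQ (c i)) := by
        rw [hν]
        exact funext fun i => by rw [hc i]
      set c' := fun i => (Ideal.span {D}).mkQ (c i) with hc'
      have hgy : g (y - s c') = 0 := by
        refine Subtype.ext ?_
        rw [map_sub, AddSubgroupClass.coe_sub, eq_neg_of_add_eq_zero_left (hgs c'), ← hb, hh,
          sub_neg_eq_add, hyb]
        rfl
      obtain ⟨x, hx⟩ := (hfg _).mp hgy
      exact ⟨(x, c'), by rw [hf', hx, sub_add_cancel, hb]⟩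
    · rintro ⟨⟨x, c⟩, hxc⟩
      rw [← hxc, hf', hg', map_add, hfg.apply_apply_eq_zero, zero_add, hgs]
  · intro x
    obtain ⟨a, ha⟩ := hspan (M'.mkQ x)
    rw [← hmod, ← sub_eq_zero, ← map_sub] at ha
    have hmem := (Submodule.Quotient.mk_eq_zero _).mp ha
    obtain ⟨y, hy⟩ := hg ⟨_, M'.neg_mem hmem⟩
    refine ⟨(y, fun i => (Ideal.span {E}).mkQ (a i)), ?_⟩
    rw [hg', hh, hy]
    simp

/-- Over a discrete valuation domain with maximal ideal `pR` and characteristic zero, every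
`R[X]`-lattice on which `X ^ (p ^ j)` acts trivially has a permutation resolution. -/
theorem hasPermutationResolution [IsPrincipalIdealRing R] [IsLocalRing R] [CharZero R] {p : ℕ}
    (hp : p.Prime) (hR : IsLocalRing.maximalIdeal R = Ideal.span {(p : R)}) (j : ℕ)
    {M : Type v} [AddCommGroup M] [Module R M] [Module R[X] M] [IsScalarTower R R[X] M]
    [Module.Finite R M] [Module.IsTorsionFree R M] (hM : ∀ x : M, (X ^ p ^ j : R[X]) • x = x) :
    HasPermutationResolution R (p ^ j) M := by
  induction j generalizing M with
  | zero => exact hasPermutationResolution_one fun x => by simpa using hM x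
  | succ j ih =>
    have : Module.Finite R[X] M := Module.Finite.of_restrictScalars_finite R _ _
    refine HasPermutationResolution.succ hp hR hM ?_
    have : Module.Finite R (Submodule.torsionBy R[X] M (X ^ p ^ j - 1 : R[X])) :=
      inferInstanceAs (Module.Finite R
        ((Submodule.torsionBy R[X] M (X ^ p ^ j - 1 : R[X])).restrictScalars R))
    have : Module.IsTorsionFree R (Submodule.torsionBy R[X] M (X ^ p ^ j - 1 : R[X])) :=
      inferInstanceAs (Module.IsTorsionFree R
        ((Submodule.torsionBy R[X] M (X ^ p ^ j - 1 : R[X])).restrictScalars R))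
    refine ih fun x => ?_
    have hx := (Submodule.mem_torsionBy_iff _ _).mp x.2
    rw [sub_smul, one_smul, sub_eq_zero] at hx
    exact Subtype.ext hx

end induction

/-! ### From `R[X]` back to the group ring -/

section groupRing

variable {R G : Type*} [CommRing R] [Group G]

theorem map_single_smul_of_generator [Finite G] {V W : Type*} [AddCommGroup V] [Module R V]
    [Module (MonoidAlgebra R G) V] [AddCommGroup W] [Module R W] [Module (MonoidAlgebra R G) W]
    {g : G} (hg : ∀ x, x ∈ Subgroup.zpowers g) (f : V →ₗ[R] W)
    (hf : ∀ v, f (MonoidAlgebra.single g (1 : R) • v) = MonoidAlgebra.single g (1 : R) • f v)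
    (x : G) (v : V) :
    f (MonoidAlgebra.single x (1 : R) • v) = MonoidAlgebra.single x (1 : R) • f v := by
  -- Finiteness of `G` makes nonnegative powers of `g` suffice.
  obtain ⟨k, rfl⟩ := (mem_powers_iff_mem_zpowers.mpr (hg x) : x ∈ Submonoid.powers g)
  have hpow : MonoidAlgebra.single (g ^ k) (1 : R) = MonoidAlgebra.single g 1 ^ k := by
    rw [MonoidAlgebra.single_pow, one_pow]
  simp only [hpow]
  induction k with
  | zero => rw [pow_zero, one_smul, one_smul]
  | succ k ih =>
    rw [pow_succ', mul_smul, mul_smul, hf, ih]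
    rw [MonoidAlgebra.single_pow, one_pow]

theorem IsPermutationOfPeriod.exists_linearEquiv [Nontrivial R] {Q : Type*} [AddCommGroup Q]
    [Module R Q] [Module R[X] Q] [IsScalarTower R R[X] Q] {g : G}
    (hg : ∀ x, x ∈ Subgroup.zpowers g) (hQ : IsPermutationOfPeriod R (Nat.card G) Q) :
    ∃ (Ω : Type) (_ : Finite Ω) (_ : MulAction G Ω) (e : Q ≃ₗ[R] PermutationModule R G Ω),
      ∀ x, e ((X : R[X]) • x) = MonoidAlgebra.single g (1 : R) • e x := by
  obtain ⟨hcard, Ω, hΩ, σ, b, hb⟩ := hQ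
  have hpow : ∀ (k : ℕ) (i : Ω), (X ^ k : R[X]) • b i = b ((σ ^ k) i) := by
    intro k i
    induction k with
    | zero => simp
    | succ k ih => rw [pow_succ', mul_smul, ih, hb, pow_succ', Equiv.Perm.mul_apply]
  -- This divisibility is what lets `g ↦ σ` extend to an action of `G`.
  have hσ : orderOf σ ∣ orderOf g := by
    rw [orderOf_eq_card_of_forall_mem_zpowers hg, orderOf_dvd_iff_pow_eq_one]
    ext i
    exact b.injective (by rw [← hpow, hcard, Equiv.Perm.one_apply])
  let φ : G →* Equiv.Perm Ω := monoidHomOfForallMemZpowers hg hσ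
  let _ : MulAction G Ω := MulAction.compHom Ω φ
  have hact : ∀ i : Ω, g • i = σ i := fun i => by
    change φ g i = σ i
    rw [monoidHomOfForallMemZpowers_apply_gen]
  let ρ := Representation.ofMulAction R G Ω
  let c : Q ≃ₗ[R] MonoidAlgebra R Ω := b.repr.trans (MonoidAlgebra.coeffLinearEquiv R).symm
  have hc : ∀ i, c (b i) = MonoidAlgebra.single i 1 := fun i => by
    rw [LinearEquiv.trans_apply, b.repr_self, LinearEquiv.symm_apply_eq]
    rfl
  let e : Q ≃ₗ[R] PermutationModule R G Ω := c.trans ρ.asModuleEquiv.symm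
  refine ⟨Ω, hΩ, inferInstance, e, fun x => ?_⟩
  have hlin : c.toLinearMap ∘ₗ Algebra.lsmul R R Q (X : R[X]) = ρ g ∘ₗ c.toLinearMap := by
    refine b.ext fun i => ?_
    change c ((X : R[X]) • b i) = ρ g (c (b i))
    rw [hb, hc, hc, Representation.ofMulAction_single, hact]
  have hx : c ((X : R[X]) • x) = ρ g (c x) := LinearMap.congr_fun hlin x
  change ρ.asModuleEquiv.symm (c ((X : R[X]) • x)) =
    MonoidAlgebra.single g (1 : R) • ρ.asModuleEquiv.symm (c x)
  rw [hx, Representation.asModuleEquiv_symm_map_rho, MonoidAlgebra.of_apply]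

end groupRing

theorem theoremC {R G M : Type*} [CommRing R] [IsDomain R] [IsDiscreteValuationRing R]
    [CharZero R] (p : ℕ) (hp : p.Prime)
    (hR : IsLocalRing.maximalIdeal R = Ideal.span {(p : R)})
    [Group G] [Finite G] [IsCyclic G] (hG : IsPGroup p G)
    [AddCommGroup M] [Module R M] [Module (MonoidAlgebra R G) M]
    [IsScalarTower R (MonoidAlgebra R G) M] (hM : IsGroupRingLattice R G M) :
    ∃ (Ω₀ Ω₁ : Type) (_ : Finite Ω₀) (_ : Finite Ω₁) (_ : MulAction G Ω₀) (_ : MulAction G Ω₁)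
      (f : PermutationModule R G Ω₁ →ₗ[MonoidAlgebra R G] PermutationModule R G Ω₀)
      (g : PermutationModule R G Ω₀ →ₗ[MonoidAlgebra R G] M),
      Function.Injective f ∧ Function.Exact f g ∧ Function.Surjective g := by
  have : Fact p.Prime := ⟨hp⟩
  obtain ⟨n, hn⟩ := IsPGroup.iff_card.mp hG
  obtain ⟨γ, hγ⟩ := IsCyclic.exists_generator (α := G)
  have := hM.finite
  have := hM.projective
  have : Module.Finite R (MonoidAlgebra R G) := inferInstance
  have : Module.Finite R M := Module.Finite.trans (MonoidAlgebra R G) M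
  have : Module.IsTorsionFree R M := inferInstance
  let a : MonoidAlgebra R G := MonoidAlgebra.single γ 1
  have ha : ∀ x : Module.AEval R M a, (Polynomial.X ^ p ^ n : Polynomial R) • x = x := by
    intro x
    obtain ⟨x, rfl⟩ := (Module.AEval.of R M a).surjective x
    rw [Module.AEval.X_pow_smul_of, MonoidAlgebra.single_pow, one_pow, ← hn, pow_card_eq_one',
      ← MonoidAlgebra.one_def, one_smul]
  have : Module.IsTorsionFree R (Module.AEval R M a) :=
    inferInstanceAs (Module.IsTorsionFree R M)
  obtain ⟨Q₁, Q₀, _, _, _, _, _, _, _, _, f, g, hQ₁, hQ₀, hf, hfg, hg⟩ :=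
    hasPermutationResolution hp hR n ha
  rw [← hn] at hQ₁ hQ₀
  obtain ⟨Ω₁, _, _, e₁, he₁⟩ := hQ₁.exists_linearEquiv hγ
  obtain ⟨Ω₀, _, _, e₀, he₀⟩ := hQ₀.exists_linearEquiv hγ
  have he₁' : ∀ v, e₁.symm (a • v) = (Polynomial.X : Polynomial R) • e₁.symm v := fun v => by
    rw [LinearEquiv.symm_apply_eq, he₁, LinearEquiv.apply_symm_apply]
  have he₀' : ∀ v, e₀.symm (a • v) = (Polynomial.X : Polynomial R) • e₀.symm v := fun v => by
    rw [LinearEquiv.symm_apply_eq, he₀, LinearEquiv.apply_symm_apply]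
  let F : PermutationModule R G Ω₁ →ₗ[R] PermutationModule R G Ω₀ :=
    e₀.toLinearMap ∘ₗ f.restrictScalars R ∘ₗ e₁.symm.toLinearMap
  let H : PermutationModule R G Ω₀ →ₗ[R] M :=
    (Module.AEval.of R M a).symm.toLinearMap ∘ₗ g.restrictScalars R ∘ₗ e₀.symm.toLinearMap
  have hF : ∀ v, F v = e₀ (f (e₁.symm v)) := fun _ => rfl
  have hH : ∀ v, H v = (Module.AEval.of R M a).symm (g (e₀.symm v)) := fun _ => rfl
  refine ⟨Ω₀, Ω₁, inferInstance, inferInstance, inferInstance, inferInstance,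
    MonoidAlgebra.equivariantOfLinearOfComm F (map_single_smul_of_generator hγ F fun v => ?_),
    MonoidAlgebra.equivariantOfLinearOfComm H (map_single_smul_of_generator hγ H fun v => ?_),
    ?_, ?_, ?_⟩
  · rw [hF, hF, he₁', map_smul, he₀]
  · rw [hH, hH, he₀', map_smul, Module.AEval.of_symm_X_smul]
  · exact e₀.injective.comp (hf.comp e₁.symm.injective)
  · intro v
    rw [MonoidAlgebra.equivariantOfLinearOfComm_apply, hH, LinearEquiv.map_eq_zero_iff,
      hfg]
    constructor
    · rintro ⟨y, hy⟩
      exact ⟨e₁ y, by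
        rw [MonoidAlgebra.equivariantOfLinearOfComm_apply, hF, e₁.symm_apply_apply, hy,
          e₀.apply_symm_apply]⟩
    · rintro ⟨y, rfl⟩
      exact ⟨e₁.symm y, by
        rw [MonoidAlgebra.equivariantOfLinearOfComm_apply, hF, e₀.symm_apply_apply]⟩
  · exact (Module.AEval.of R M a).symm.surjective.comp (hg.comp e₀.symm.surjective)
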